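/- For a finite-dimensional real vector space $W$, write $W^{\vee}=\mathrm{Hom}_{\mathbb R}(W,\mathbb R)$, let $\mathrm{Sym}_{\mathbb R}W$ be the symmetric algebra of $W$, and let $C^{\infty}(W^{\vee},\mathbb R)$ be the space of smooth real-valued functions on $W^{\vee}$. There is a natural algebra homomorphism $\mathrm{Sym}_{\mathbb R}W\to C^{\infty}(W^{\vee},\mathbb R)$ sending $w\in W$ to the linear function $\varphi\mapsto\varphi(w)$, i.e. the inclusion of the polynomial functions into the smooth functions. Both sides are covariant functors of $W$ (a linear map $g\colon W\to W'$ acts on smooth functions by pullback along $g^{\vee}\colon W'^{\vee}\to W^{\vee}$). The cohomology $\mathrm H^{*}$ of a cosimplicial real vector space is the cohomology of its associated cochain complex, whose differential is the alternating sum of the coface maps, and a morphism of cosimplicial real vector spaces is a quasi-isomorphism if it induces isomorphisms on all cohomology groups. **Proposition 3.5.** Let $V$ be a cosimplicial real vector space such that each $V^n$ is finite-dimensional and $\mathrm H^0V=0$. Then the natural morphism $$\mathrm{Sym}_{\mathbb R}V\longrightarrow C^{\infty}(V^{\vee},\mathbb R)$$ of cosimplicial real vector spaces, given in level $n$ by $\mathrm{Sym}_{\mathbb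 R}(V^n)\to C^{\infty}((V^n)^{\vee},\mathbb R)$, is a quasi-isomorphism. -/

import Mathlib

open CategoryTheory
open scoped ContDiff

universe u

noncomputable section

namespace SymSmooth

section Smooth

variable {W W' : Type u} [AddCommGroup W] [Module ℝ W] [AddCommGroup W'] [Module ℝ W']

/-- A real function on a real vector space `W` is smooth if its pullback along every linear map
`ℝⁿ → W` is `C^∞`. If `W` is finite-dimensional this is the usual notion of smoothness,
see `isSmooth_iff_comp_equiv` and `isSmooth_iff_contDiff`. -/
def IsSmooth (f : W → ℝ) : Prop :=
  ∀ (n : ℕ) (L : (Fin n → ℝ) →ₗ[ℝ] W), ContDiff ℝ ∞ (fun x : Fin n → ℝ => f (L x))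

/-- Smoothness can be tested in any one linear coordinate system. -/
theorem isSmooth_iff_comp_equiv {n : ℕ} (e : (Fin n → ℝ) ≃ₗ[ℝ] W) (f : W → ℝ) :
    IsSmooth f ↔ ContDiff ℝ ∞ (fun x : Fin n → ℝ => f (e x)) := by
  refine ⟨fun h => h n e.toLinearMap, fun h m L => ?_⟩
  have h1 := h.comp (LinearMap.toContinuousLinearMap (e.symm.toLinearMap ∘ₗ L)).contDiff
  convert h1 using 1
  ext x
  simp

/-- On a finite-dimensional normed space, `IsSmooth` is Mathlib's `ContDiff ℝ ∞`. -/
theorem isSmooth_iff_contDiff {E : Type u} [NormedAddCommGroup E] [NormedSpace ℝ E]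
    [FiniteDimensional ℝ E] (f : E → ℝ) : IsSmooth f ↔ ContDiff ℝ ∞ f := by
  refine ⟨fun h => ?_, fun h n L => h.comp (LinearMap.toContinuousLinearMap L).contDiff⟩
  let e := (Module.finBasis ℝ E).equivFun
  have h1 := (h _ e.symm.toLinearMap).comp (LinearMap.toContinuousLinearMap e.toLinearMap).contDiff
  convert h1 using 1
  ext x
  simp

variable (W) in
/-- The real algebra `C^∞(W, ℝ)` of smooth functions on a (finite-dimensional) real vector
space. -/
def smoothFunctions : Subalgebra ℝ (W → ℝ) where
  carrier := {f | IsSmooth f}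
  mul_mem' hf hg n L := (hf n L).mul (hg n L)
  add_mem' hf hg n L := (hf n L).add (hg n L)
  algebraMap_mem' _ _ _ := contDiff_const

/-- Pullback of smooth functions along a linear map. -/
def smoothPullback (g : W →ₗ[ℝ] W') : smoothFunctions W' →ₗ[ℝ] smoothFunctions W where
  toFun f := ⟨fun w => (f : W' → ℝ) (g w), fun n L => f.2 n (g ∘ₗ L)⟩
  map_add' _ _ := rfl
  map_smul' _ _ := rfl

variable (W) in
/-- The linear map `W → C^∞(W^∨, ℝ)` regarding a vector as a linear function on the dual. -/
def evalDual : W →ₗ[ℝ] smoothFunctions (Module.Dual ℝ W) where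
  toFun v := ⟨fun φ => φ v, fun _ L =>
    (LinearMap.toContinuousLinearMap (Module.Dual.eval ℝ W v ∘ₗ L)).contDiff⟩
  map_add' v w := Subtype.ext (funext fun φ => map_add φ v w)
  map_smul' c v := Subtype.ext (funext fun φ => map_smul φ c v)

variable (W) in
/-- The natural algebra homomorphism `Sym_ℝ W → C^∞(W^∨, ℝ)` regarding an element of the symmetric
algebra as a polynomial function on the dual. -/
def symToSmooth : SymmetricAlgebra ℝ W →ₐ[ℝ] smoothFunctions (Module.Dual ℝ W) :=
  SymmetricAlgebra.lift (evalDual W)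

/-- Functoriality of the symmetric algebra. -/
def symMap (g : W →ₗ[ℝ] W') : SymmetricAlgebra ℝ W →ₐ[ℝ] SymmetricAlgebra ℝ W' :=
  SymmetricAlgebra.lift (SymmetricAlgebra.ι ℝ W' ∘ₗ g)

theorem symToSmooth_naturality (g : W →ₗ[ℝ] W') (x : SymmetricAlgebra ℝ W) :
    symToSmooth W' (symMap g x) = smoothPullback g.dualMap (symToSmooth W x) := by
  induction x using SymmetricAlgebra.induction with
  | algebraMap r => simp only [AlgHom.commutes]; rfl
  | ι v => simp only [symToSmooth, symMap, SymmetricAlgebra.lift_ι_apply, LinearMap.comp_apply]; rfl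
  | mul a b ha hb => simp only [map_mul, ha, hb]; rfl
  | add a b ha hb => simp only [map_add, ha, hb]

end Smooth

/-- The functor `W ↦ Sym_ℝ W`, with values in real vector spaces. -/
def symFunctor : ModuleCat.{u} ℝ ⥤ ModuleCat.{u} ℝ where
  obj W := ModuleCat.of ℝ (SymmetricAlgebra ℝ W)
  map g := ModuleCat.ofHom (symMap g.hom).toLinearMap
  map_id W := by
    have h : symMap (LinearMap.id : W →ₗ[ℝ] W) = AlgHom.id ℝ _ := by
      ext v; simp [symMap]
    ext x
    exact DFunLike.congr_fun h x
  map_comp {W W' W''} g g' := by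
    have h : symMap (g'.hom ∘ₗ g.hom) = (symMap g'.hom).comp (symMap g.hom) := by
      ext v; simp [symMap]
    ext x
    exact DFunLike.congr_fun h x

/-- The functor `W ↦ C^∞(W^∨, ℝ)`, with values in real vector spaces. -/
def smoothDualFunctor : ModuleCat.{u} ℝ ⥤ ModuleCat.{u} ℝ where
  obj W := ModuleCat.of ℝ (smoothFunctions (Module.Dual ℝ W))
  map g := ModuleCat.ofHom (smoothPullback g.hom.dualMap)
  map_id _ := rfl
  map_comp _ _ := rfl

/-- The natural transformation `Sym_ℝ W → C^∞(W^∨, ℝ)`. -/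
def symToSmoothNatTrans : symFunctor.{u} ⟶ smoothDualFunctor.{u} where
  app W := ModuleCat.ofHom (symToSmooth W).toLinearMap
  naturality W W' g := by
    ext x
    exact symToSmooth_naturality g.hom x

/-- The natural morphism `Sym_ℝ V → C^∞(V^∨, ℝ)` of cosimplicial real vector spaces, given in each
cosimplicial level by `symToSmooth`. -/
def cosimplicialSymToSmooth (V : CosimplicialObject (ModuleCat.{u} ℝ)) :
    ((CosimplicialObject.whiskering _ _).obj symFunctor).obj V ⟶
      ((CosimplicialObject.whiskering _ _).obj smoothDualFunctor).obj V :=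
  ((CosimplicialObject.whiskering _ _).map symToSmoothNatTrans).app V

/-- The cochain complex of a cosimplicial real vector space, with differential the alternating sum
of the coface maps. Its cohomology is the cohomology of the cosimplicial vector space. -/
abbrev cochains : CosimplicialObject (ModuleCat.{u} ℝ) ⥤ CochainComplex (ModuleCat.{u} ℝ) ℕ :=
  AlgebraicTopology.alternatingCofaceMapComplex (ModuleCat.{u} ℝ)

end SymSmooth

end

/-!
Write `Q(W)` for the space of smooth functions on `W^∨` modulo polynomial functions. Polynomial
functions on a finite-dimensional real vector space are determined by their values, so
`Sym W → C^∞(W^∨)` is injective (`SymSmooth.symToSmooth_injective`), and it has to be shown that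
the cosimplicial vector space `Q(V)` has vanishing cohomology.

The key is Hadamard's lemma. For a basis `e` of `W` with dual basis `e^∨`,
`f - f(0) = ∑ i, e i * D (e^∨ i) f`, where `D φ f` at `x` is the mean over `t ∈ [0, 1]` of the
derivative of `f` at `t x` in the direction `φ`. The operators `D φ` preserve polynomial functions.
Hence multiplication `W ⊗ Q(W) → Q(W)` has the section `f ↦ ∑ i, e i ⊗ D (e^∨ i) f`
(`SymSmooth.SmoothModPoly.mul_split`), and both maps are natural in `W`. So the cosimplicial vector
space `Q(V)` is a retract of the levelwise tensor product `V ⊗ Q(V)`.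

By a case of the Künneth theorem (`CosimplicialModule.cohomologyVanishes_tensor`), if `H^0 V = 0`
and `H^m B = 0` for all `m < n`, then `H^n (V ⊗ B) = 0`. With `B = Q(V)`, induction on `n` gives
`H^n (Q(V)) = 0` for all `n`.

The case of the Künneth theorem is proved by induction on `n` as well. For `n = 0` it is immediate
from flatness. If `H^0 B = 0`, then `B` embeds into its cone, the quotient of the décalage
`[n] ↦ B^{n+1}` by its constant part. The cone is contractible, levelwise over all morphisms to
`[1]`, and therefore so is its tensor product with `V`; the long exact sequences for the cone and
its quotient by `B` reduce the claim for `B` to the claim for that quotient in one degree less.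
That the two ends of a homotopy given levelwise by the morphisms to `[1]` agree on cohomology
(`CosimplicialModule.IntervalHomotopy.act_sub_act_mem_boundaries`) is proved by dimension shifting
along the embedding into the décalage, without the usual alternating sums of degeneracies.
-/

noncomputable section

open scoped Simplicial TensorProduct
open SimplexCategory (δ σ)

namespace CosimplicialModule

universe v

variable {K : Type v} [CommRing K]

/-! ### Cohomology of cosimplicial modules -/

section Cohomology

variable {F G C : SimplexCategory ⥤ ModuleCat.{u} K}

variable (F) in
/-- The differential of the cochain complex of a cosimplicial module, as a linear map: the
alternating sum of the coface maps. -/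
def coboundary (n : ℕ) : F.obj ⦋n⦌ →ₗ[K] F.obj ⦋n + 1⦌ :=
  ∑ i : Fin (n + 2), (-1 : ℤ) ^ (i : ℕ) • (F.map (δ i)).hom

theorem coboundary_apply (n : ℕ) (x : F.obj ⦋n⦌) :
    coboundary F n x = ∑ i : Fin (n + 2), (-1 : ℤ) ^ (i : ℕ) • (F.map (δ i)).hom x := by
  simp [coboundary]

theorem coboundary_zero_apply (x : F.obj ⦋0⦌) :
    coboundary F 0 x = (F.map (δ 0)).hom x - (F.map (δ 1)).hom x := by
  simp [coboundary_apply, Fin.sum_univ_two, ← sub_eq_add_neg]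

theorem hom_coboundary (n : ℕ) :
    (AlgebraicTopology.AlternatingCofaceMapComplex.objD F n).hom = coboundary F n := by
  simp [coboundary, CosimplicialObject.δ, ModuleCat.hom_sum]

theorem coboundary_comp (n : ℕ) (x : F.obj ⦋n⦌) :
    coboundary F (n + 1) (coboundary F n x) = 0 := by
  have h := AlgebraicTopology.AlternatingCofaceMapComplex.d_squared F n
  have h' := congrArg (fun f => f.hom x) h
  rw [ModuleCat.hom_comp, hom_coboundary, hom_coboundary] at h'
  exact h'

variable (F) in
/-- The coboundaries in degree `n`; there are none but `0` in degree `0`. -/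
def boundaries (n : ℕ) : Submodule K (F.obj ⦋n⦌) :=
  match n with
  | 0 => ⊥
  | n + 1 => LinearMap.range (coboundary F n)

variable (F) in
/-- The vanishing of the `n`-th cohomology of a cosimplicial module. -/
def CohomologyVanishes (n : ℕ) : Prop :=
  ∀ x : F.obj ⦋n⦌, coboundary F n x = 0 → x ∈ boundaries F n

theorem coboundary_of_mem_boundaries {n : ℕ} {x : F.obj ⦋n⦌} (hx : x ∈ boundaries F n) :
    coboundary F n x = 0 := by
  cases n with
  | zero => rw [(Submodule.mem_bot K).1 hx, map_zero]
  | succ n => obtain ⟨y, rfl⟩ := hx; exact coboundary_comp n y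

theorem naturality_apply (φ : F ⟶ G) {Δ Δ' : SimplexCategory} (θ : Δ ⟶ Δ') (x : F.obj Δ) :
    (φ.app Δ').hom ((F.map θ).hom x) = (G.map θ).hom ((φ.app Δ).hom x) :=
  congrArg (fun f => f.hom x) (φ.naturality θ)

theorem map_map_apply {Δ Δ' Δ'' : SimplexCategory} (θ : Δ ⟶ Δ') (θ' : Δ' ⟶ Δ'') (x : F.obj Δ) :
    (F.map θ').hom ((F.map θ).hom x) = (F.map (θ ≫ θ')).hom x := by
  rw [F.map_comp]; rfl

theorem map_id_apply {Δ : SimplexCategory} (x : F.obj Δ) : (F.map (𝟙 Δ)).hom x = x := by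
  rw [F.map_id]; rfl

theorem coboundary_naturality (φ : F ⟶ G) (n : ℕ) (x : F.obj ⦋n⦌) :
    coboundary G n ((φ.app ⦋n⦌).hom x) = (φ.app ⦋n + 1⦌).hom (coboundary F n x) := by
  simp only [coboundary_apply, map_sum, map_zsmul, naturality_apply]

theorem app_mem_boundaries (φ : F ⟶ G) {n : ℕ} {x : F.obj ⦋n⦌} (hx : x ∈ boundaries F n) :
    (φ.app ⦋n⦌).hom x ∈ boundaries G n := by
  cases n with
  | zero => rw [(Submodule.mem_bot K).1 hx, map_zero]; exact zero_mem _
  | succ n =>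
    obtain ⟨y, rfl⟩ := hx
    exact ⟨(φ.app ⦋n⦌).hom y, coboundary_naturality φ n y⟩

theorem exists_mem_boundaries_of_surjective (φ : F ⟶ G)
    (hφ : ∀ Δ, Function.Surjective (φ.app Δ).hom) {n : ℕ} {y : G.obj ⦋n⦌}
    (hy : y ∈ boundaries G n) : ∃ x ∈ boundaries F n, (φ.app ⦋n⦌).hom x = y := by
  cases n with
  | zero => exact ⟨0, zero_mem _, by rw [map_zero, (Submodule.mem_bot K).1 hy]⟩
  | succ n =>
    obtain ⟨z, rfl⟩ := hy
    obtain ⟨w, rfl⟩ := hφ _ z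
    exact ⟨coboundary F n w, ⟨w, rfl⟩, (coboundary_naturality φ n w).symm⟩

/-- A retract of a cosimplicial module with vanishing cohomology has vanishing cohomology. -/
theorem CohomologyVanishes.of_retract (s : F ⟶ G) (r : G ⟶ F) (h : s ≫ r = 𝟙 F) {n : ℕ}
    (hG : CohomologyVanishes G n) : CohomologyVanishes F n := by
  intro x hx
  have h1 := app_mem_boundaries r (hG ((s.app _).hom x)
    (by rw [coboundary_naturality, hx, map_zero]))
  have h2 : (r.app ⦋n⦌).hom ((s.app ⦋n⦌).hom x) = x :=
    congrArg (fun f => (f.app ⦋n⦌).hom x) h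
  rwa [h2] at h1

/-- A levelwise short exact sequence of cosimplicial modules. -/
structure IsShortExact (φ : F ⟶ G) (π : G ⟶ C) : Prop where
  injective : ∀ Δ, Function.Injective (φ.app Δ).hom
  exact : ∀ Δ, Function.Exact (φ.app Δ).hom (π.app Δ).hom
  surjective : ∀ Δ, Function.Surjective (π.app Δ).hom

variable {φ : F ⟶ G} {π : G ⟶ C}

/-- The vanishing of `H^(n+1) F` read off from the long exact sequence. -/
theorem IsShortExact.cohomologyVanishes_left_succ (h : IsShortExact φ π) {n : ℕ}
    (hG : CohomologyVanishes G (n + 1)) (hC : CohomologyVanishes C n) :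
    CohomologyVanishes F (n + 1) := by
  intro x hx
  obtain ⟨y, hy⟩ := hG ((φ.app _).hom x) (by rw [coboundary_naturality, hx, map_zero])
  have h1 : (π.app ⦋n⦌).hom y ∈ boundaries C n := hC _ (by
    rw [coboundary_naturality, hy]; exact (h.exact _).apply_apply_eq_zero x)
  obtain ⟨b, hb, hb'⟩ := exists_mem_boundaries_of_surjective π h.surjective h1
  obtain ⟨z, hz⟩ := (h.exact _ (y - b)).1 (by rw [map_sub, hb', sub_self])
  refine ⟨z, h.injective _ ?_⟩
  rw [← coboundary_naturality, hz, map_sub, coboundary_of_mem_boundaries hb, sub_zero, hy]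

/-- The vanishing of `H^n C` read off from the long exact sequence. -/
theorem IsShortExact.cohomologyVanishes_right (h : IsShortExact φ π) {n : ℕ}
    (hG : CohomologyVanishes G n) (hF : CohomologyVanishes F (n + 1)) :
    CohomologyVanishes C n := by
  intro x hx
  obtain ⟨y, rfl⟩ := h.surjective _ x
  rw [coboundary_naturality] at hx
  obtain ⟨z, hz⟩ := (h.exact _ _).1 hx
  obtain ⟨w, hw⟩ := hF z (h.injective _ (by
    rw [← coboundary_naturality, hz, coboundary_comp, map_zero]))
  have h1 : y - (φ.app _).hom w ∈ boundaries G n := hG _ (by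
    rw [map_sub, coboundary_naturality, hw, hz, sub_self])
  have h2 := app_mem_boundaries π h1
  rwa [map_sub, (h.exact _).apply_apply_eq_zero, sub_zero] at h2

/-- The levelwise cokernel of a morphism of cosimplicial modules, as a quotient module. -/
def coker (φ : F ⟶ G) : SimplexCategory ⥤ ModuleCat.{u} K where
  obj Δ := ModuleCat.of K (G.obj Δ ⧸ LinearMap.range (φ.app Δ).hom)
  map {Δ Δ'} θ := ModuleCat.ofHom (Submodule.mapQ _ _ (G.map θ).hom (by
    rintro _ ⟨x, rfl⟩
    exact ⟨(F.map θ).hom x, naturality_apply φ θ x⟩))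
  map_id Δ := by
    ext x
    simp
  map_comp θ θ' := by
    ext x
    simp

/-- The projection to the levelwise cokernel. -/
def cokerπ (φ : F ⟶ G) : G ⟶ coker φ where
  app _ := ModuleCat.ofHom (Submodule.mkQ _)
  naturality _ _ _ := rfl

theorem cokerπ_surjective (φ : F ⟶ G) (Δ : SimplexCategory) :
    Function.Surjective ((cokerπ φ).app Δ).hom :=
  Submodule.mkQ_surjective _

theorem cokerπ_exact (φ : F ⟶ G) (Δ : SimplexCategory) :
    Function.Exact (φ.app Δ).hom ((cokerπ φ).app Δ).hom :=
  LinearMap.exact_map_mkQ_range _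

theorem isShortExact_coker (hφ : ∀ Δ, Function.Injective (φ.app Δ).hom) :
    IsShortExact φ (cokerπ φ) :=
  ⟨hφ, cokerπ_exact φ, cokerπ_surjective φ⟩

end Cohomology

/-! ### Décalage and homotopies -/

/-- The endofunctor `[n] ↦ [n + 1]` of the simplex category that adjoins a new least element. -/
abbrev shift : SimplexCategory ⥤ SimplexCategory where
  obj Δ := ⦋Δ.len + 1⦌
  map {Δ Δ'} θ := SimplexCategory.Hom.mk
    { toFun := Fin.cases 0 (fun k => (θ.toOrderHom k).succ)
      monotone' := by
        intro a b hab
        induction a using Fin.cases with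
        | zero => exact Fin.zero_le _
        | succ a =>
          induction b using Fin.cases with
          | zero => exact absurd hab (by simp)
          | succ b => simpa using θ.toOrderHom.monotone (Fin.succ_le_succ_iff.1 hab) }
  map_id Δ := by
    ext a : 3
    induction a using Fin.cases <;> rfl
  map_comp θ θ' := by
    ext a : 3
    induction a using Fin.cases <;> rfl

/-- The inclusion of `[n]` into `[n + 1]` that misses the new least element. -/
def shiftInclusion : 𝟭 SimplexCategory ⟶ shift where
  app Δ := δ (n := Δ.len) 0
  naturality _ _ _ := by
    ext a : 3
    rfl

theorem δ_zero_comp_shift_map {Δ Δ' : SimplexCategory} (θ : Δ ⟶ Δ') :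
    δ (n := Δ.len) 0 ≫ shift.map θ = θ ≫ δ (n := Δ'.len) 0 :=
  (shiftInclusion.naturality θ).symm

theorem shift_map_δ {n : ℕ} (i : Fin (n + 2)) : shift.map (δ i) = δ i.succ := by
  ext a : 3
  induction a using Fin.cases with
  | zero => exact (Fin.succ_succAbove_zero i).symm
  | succ a => exact (Fin.succ_succAbove_succ i a).symm

theorem δ_zero_comp_σ_zero {n : ℕ} : δ (n := n) 0 ≫ σ 0 = 𝟙 _ :=
  SimplexCategory.δ_comp_σ_self (i := (0 : Fin (n + 1)))

/-- The décalage of a cosimplicial module. -/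
abbrev dec (F : SimplexCategory ⥤ ModuleCat.{u} K) : SimplexCategory ⥤ ModuleCat.{u} K :=
  shift ⋙ F

section Dec

variable (F : SimplexCategory ⥤ ModuleCat.{u} K)

/-- The morphism from a cosimplicial module to its décalage given by the zeroth coface maps. -/
def toDec : F ⟶ dec F := Functor.whiskerRight shiftInclusion F

theorem toDec_injective (Δ : SimplexCategory) : Function.Injective ((toDec F).app Δ).hom := by
  apply Function.LeftInverse.injective (g := (F.map (σ (n := Δ.len) 0)).hom)
  intro x
  refine (map_map_apply (F := F) (δ (n := Δ.len) 0) (σ (n := Δ.len) 0) x).trans ?_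
  rw [δ_zero_comp_σ_zero]
  exact map_id_apply x

/-- The differential of the décalage is, up to sign, that of `F` without the zeroth coface map. -/
theorem coboundary_dec (n : ℕ) (x : F.obj ⦋n + 1⦌) :
    (coboundary (dec F) n x : F.obj ⦋n + 2⦌) =
      (F.map (δ 0)).hom x - coboundary F (n + 1) x := by
  refine (coboundary_apply (F := dec F) n x).trans ?_
  rw [coboundary_apply, Fin.sum_univ_succ (n := n + 2)]
  have h (i : Fin (n + 2)) : ((dec F).map (δ i)).hom x = (F.map (δ i.succ)).hom x := by
    rw [← shift_map_δ]; rfl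
  simp only [Fin.val_zero, pow_zero, one_smul, Fin.val_succ, pow_succ, mul_neg, mul_one,
    neg_smul, Finset.sum_neg_distrib, sub_add_cancel_left, neg_neg]
  exact Finset.sum_congr rfl fun i _ => congrArg _ (h i)

end Dec

/-- A natural family of endomorphisms of the levels of a cosimplicial module, indexed by the
morphisms to `[1]`. It is a homotopy between the endomorphisms of the cosimplicial module that
belong to the two constant morphisms. -/
structure IntervalHomotopy (F : SimplexCategory ⥤ ModuleCat.{u} K) where
  /-- The endomorphism in level `Δ` belonging to a morphism from `Δ` to `[1]`. -/
  act {Δ : SimplexCategory} (α : Δ ⟶ ⦋1⦌) : F.obj Δ →ₗ[K] F.obj Δ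
  map_act {Δ Δ' : SimplexCategory} (θ : Δ ⟶ Δ') (α : Δ' ⟶ ⦋1⦌) (x : F.obj Δ) :
    (F.map θ).hom (act (θ ≫ α) x) = act α ((F.map θ).hom x)

namespace IntervalHomotopy

variable {F : SimplexCategory ⥤ ModuleCat.{u} K} (H : IntervalHomotopy F)

theorem act_coboundary (e : Fin 2) (n : ℕ) (x : F.obj ⦋n⦌) :
    coboundary F n (H.act (SimplexCategory.const _ _ e) x) =
      H.act (SimplexCategory.const _ _ e) (coboundary F n x) := by
  simp only [coboundary_apply, map_sum, map_zsmul]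
  exact Finset.sum_congr rfl fun i _ => congrArg _ (H.map_act (δ i) (SimplexCategory.const _ _ e) x)

/-- A homotopy induces one on the décalage: a morphism from `[n]` to `[1]` is extended by the
value `0` at the new least element. -/
def dec : IntervalHomotopy (dec F) where
  act α := H.act (shift.map α ≫ σ 0)
  map_act θ α x := by
    have h : shift.map (θ ≫ α) ≫ σ 0 = shift.map θ ≫ shift.map α ≫ σ 0 := by
      rw [shift.map_comp, Category.assoc]
    exact (congrArg (fun β => (F.map (shift.map θ)).hom (H.act β x)) h).trans
      (H.map_act (shift.map θ) (shift.map α ≫ σ 0) x)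

theorem map_δ_zero_act {Δ : SimplexCategory} (α : Δ ⟶ ⦋1⦌) (x : F.obj Δ) :
    (F.map (δ (n := Δ.len) 0)).hom (H.act α x) =
      H.dec.act α ((F.map (δ (n := Δ.len) 0)).hom x) := by
  have h : δ (n := Δ.len) 0 ≫ shift.map α ≫ σ 0 = α := by
    rw [← Category.assoc, δ_zero_comp_shift_map, Category.assoc]
    exact (congrArg (α ≫ ·) δ_zero_comp_σ_zero).trans (Category.comp_id α)
  exact (congrArg (fun β => (F.map (δ (n := Δ.len) 0)).hom (H.act β x)) h.symm).trans
    (H.map_act (δ (n := Δ.len) 0) (shift.map α ≫ σ 0) x)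

/-- A homotopy on `F` that preserves the image of a morphism to `F` induces one on the cokernel. -/
def coker {E : SimplexCategory ⥤ ModuleCat.{u} K} (φ : E ⟶ F)
    (h : ∀ {Δ : SimplexCategory} (α : Δ ⟶ ⦋1⦌) (x : E.obj Δ),
      H.act α ((φ.app Δ).hom x) ∈ LinearMap.range (φ.app Δ).hom) :
    IntervalHomotopy (coker φ) where
  act {Δ} α := Submodule.mapQ _ _ (H.act α) (by rintro _ ⟨x, rfl⟩; exact h α x)
  map_act {Δ Δ'} θ α x := by
    obtain ⟨x, rfl⟩ := cokerπ_surjective φ Δ x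
    exact congrArg ((cokerπ φ).app Δ').hom (H.map_act θ α x)

/-- The two ends of a homotopy agree on cohomology. A cocycle `x` of degree `n + 1` also represents
a cocycle of degree `n` in the quotient of the décalage by `F`, since the differential of the
décalage sends it to its zeroth coface. The claim for this class, to which the differential of the
décalage is applied again, gives the claim for `x`. -/
theorem act_sub_act_mem_boundaries (n : ℕ) {F : SimplexCategory ⥤ ModuleCat.{u} K}
    (H : IntervalHomotopy F) (x : F.obj ⦋n⦌) (hx : coboundary F n x = 0) :
    H.act (SimplexCategory.const _ _ 1) x - H.act (SimplexCategory.const _ _ 0) x ∈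
      boundaries F n := by
  induction n generalizing F with
  | zero =>
    rw [coboundary_zero_apply, sub_eq_zero] at hx
    have h0 := H.map_act (δ 0) (𝟙 ⦋1⦌) x
    have h1 := H.map_act (δ 1) (𝟙 ⦋1⦌) x
    have e0 : δ 0 ≫ 𝟙 ⦋1⦌ = SimplexCategory.const ⦋0⦌ ⦋1⦌ 1 := by
      ext a : 3; fin_cases a; rfl
    have e1 : δ 1 ≫ 𝟙 ⦋1⦌ = SimplexCategory.const ⦋0⦌ ⦋1⦌ 0 := by
      ext a : 3; fin_cases a; rfl
    rw [e0, hx] at h0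
    rw [e1, ← h0] at h1
    have h2 := congrArg (F.map (σ 0)).hom h1
    have s1 : δ (n := 0) 1 ≫ σ 0 = 𝟙 _ := SimplexCategory.δ_comp_σ_succ (i := (0 : Fin 1))
    rw [map_map_apply, map_map_apply, s1, δ_zero_comp_σ_zero, map_id_apply, map_id_apply] at h2
    rw [h2, sub_self]
    exact zero_mem _
  | succ n ih =>
    let HQ : IntervalHomotopy (CosimplicialModule.coker (toDec F)) :=
      H.dec.coker (toDec F) fun α y => ⟨H.act α y, H.map_δ_zero_act α y⟩
    have hdec : coboundary (CosimplicialModule.dec F) n x = ((toDec F).app ⦋n + 1⦌).hom x := by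
      refine (coboundary_dec F n x).trans ?_
      rw [hx, sub_zero]
      rfl
    have h1 := ih HQ (((cokerπ (toDec F)).app ⦋n⦌).hom x) (by
      rw [coboundary_naturality, hdec]
      exact (cokerπ_exact (toDec F) _).apply_apply_eq_zero x)
    obtain ⟨b, hb, hb'⟩ := exists_mem_boundaries_of_surjective _ (cokerπ_surjective (toDec F)) h1
    obtain ⟨y, hy⟩ := (cokerπ_exact (toDec F) ⦋n⦌
      (H.dec.act (SimplexCategory.const _ _ 1) x - H.dec.act (SimplexCategory.const _ _ 0) x
        - b)).1 (by rw [map_sub, hb', sub_eq_zero]; rfl)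
    refine ⟨y, toDec_injective F _ ?_⟩
    have hend (e : Fin 2) : coboundary (CosimplicialModule.dec F) n
        (H.dec.act (SimplexCategory.const ⦋n⦌ ⦋1⦌ e) x) =
        ((toDec F).app ⦋n + 1⦌).hom (H.act (SimplexCategory.const _ _ e) x) := by
      rw [act_coboundary, hdec]
      exact (H.map_δ_zero_act (SimplexCategory.const _ _ e) x).symm
    rw [← coboundary_naturality, hy, map_sub, map_sub, hend, hend,
      coboundary_of_mem_boundaries hb, sub_zero, ← map_sub]

end IntervalHomotopy

/-! ### The cone of a cosimplicial module -/

section Cone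

variable {K : Type v} [CommRing K] (F : SimplexCategory ⥤ ModuleCat.{u} K)

/-- The least vertex of `[n + 1]`. -/
abbrev leastVertex (Δ : SimplexCategory) : ⦋0⦌ ⟶ shift.obj Δ := SimplexCategory.const _ _ 0

theorem leastVertex_comp_shift_map {Δ Δ' : SimplexCategory} (θ : Δ ⟶ Δ') :
    leastVertex Δ ≫ shift.map θ = leastVertex Δ' := rfl

/-- For `α : [n] ⟶ [1]`, the endomorphism of `[n + 1]` that moves to the new least element all
elements of `[n]` at which `α` is `0`, and fixes the others. -/
def contraction {Δ : SimplexCategory} (α : Δ ⟶ ⦋1⦌) : shift.obj Δ ⟶ shift.obj Δ :=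
  SimplexCategory.Hom.mk
    { toFun := Fin.cases 0 (fun k => if α.toOrderHom k = 0 then 0 else k.succ)
      monotone' := by
        intro a b hab
        induction a using Fin.cases with
        | zero => exact Fin.zero_le _
        | succ a =>
          induction b using Fin.cases with
          | zero => exact absurd hab (by simp)
          | succ b =>
            have hab' := Fin.succ_le_succ_iff.1 hab
            have h := α.toOrderHom.monotone hab'
            simp only [Fin.cases_succ]
            split_ifs with ha hb
            · exact le_rfl
            · exact Fin.zero_le _
            · rw [‹α.toOrderHom b = 0›] at h
              exact absurd (le_antisymm h (Fin.zero_le _)) ha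
            · exact hab }

theorem contraction_naturality {Δ Δ' : SimplexCategory} (θ : Δ ⟶ Δ') (α : Δ' ⟶ ⦋1⦌) :
    contraction (θ ≫ α) ≫ shift.map θ = shift.map θ ≫ contraction α := by
  ext a : 3
  induction a using Fin.cases with
  | zero => rfl
  | succ a =>
    change (shift.map θ).toOrderHom (if α.toOrderHom (θ.toOrderHom a) = 0 then 0 else a.succ) =
      if α.toOrderHom (θ.toOrderHom a) = 0 then 0 else (θ.toOrderHom a).succ
    split_ifs <;> rfl

theorem contraction_const_one (Δ : SimplexCategory) :
    contraction (SimplexCategory.const Δ ⦋1⦌ 1) = 𝟙 _ := by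
  ext a : 3
  induction a using Fin.cases <;> rfl

theorem contraction_const_zero (Δ : SimplexCategory) :
    contraction (SimplexCategory.const Δ ⦋1⦌ 0) =
      SimplexCategory.const _ ⦋0⦌ 0 ≫ leastVertex Δ := by
  ext a : 3
  induction a using Fin.cases <;> rfl

/-- The morphism from a constant cosimplicial module to the décalage given by the least vertex. -/
def constToDec : (Functor.const _).obj (F.obj ⦋0⦌) ⟶ dec F where
  app Δ := F.map (leastVertex Δ)
  naturality Δ Δ' θ := by
    refine (Category.id_comp _).trans ?_
    rw [← leastVertex_comp_shift_map θ, F.map_comp]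
    rfl

/-- The quotient of the décalage by the constant part, which is contractible. -/
def cone : SimplexCategory ⥤ ModuleCat.{u} K := coker (constToDec F)

/-- The contraction of the décalage to its least vertex. -/
def decHomotopy : IntervalHomotopy (dec F) where
  act α := (F.map (contraction α)).hom
  map_act θ α x := by
    refine (map_map_apply (F := F) (contraction (θ ≫ α)) (shift.map θ) x).trans
      (Eq.trans ?_ (map_map_apply (F := F) (shift.map θ) (contraction α) x).symm)
    rw [contraction_naturality]

/-- The contraction of the cone. -/
def coneHomotopy : IntervalHomotopy (cone F) :=
  (decHomotopy F).coker (constToDec F) fun α x =>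
    ⟨x, (map_map_apply (F := F) (leastVertex _) (contraction α) x).symm⟩

theorem coneHomotopy_act_one (Δ : SimplexCategory) (x : (cone F).obj Δ) :
    (coneHomotopy F).act (SimplexCategory.const Δ ⦋1⦌ 1) x = x := by
  obtain ⟨x, rfl⟩ := cokerπ_surjective (constToDec F) Δ x
  refine congrArg ((cokerπ (constToDec F)).app Δ).hom ?_
  change (F.map (contraction _)).hom x = x
  rw [contraction_const_one]
  exact map_id_apply (F := F) x

theorem coneHomotopy_act_zero (Δ : SimplexCategory) (x : (cone F).obj Δ) :
    (coneHomotopy F).act (SimplexCategory.const Δ ⦋1⦌ 0) x = 0 := by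
  obtain ⟨x, rfl⟩ := cokerπ_surjective (constToDec F) Δ x
  refine (cokerπ_exact (constToDec F) Δ _).2 ⟨(F.map (SimplexCategory.const _ ⦋0⦌ 0)).hom x, ?_⟩
  refine (map_map_apply (F := F) _ (leastVertex Δ) x).trans ?_
  rw [← contraction_const_zero]
  rfl

/-- A cosimplicial module maps to its cone. -/
def toCone : F ⟶ cone F := toDec F ≫ cokerπ (constToDec F)

/-- If `δ 0` sends `x` to the constant part of the décalage, then the morphism `[n + 1] ⟶ [1]` that
separates the least element from the others exhibits the constant as a cocycle of degree `0`. -/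
theorem toCone_injective (h : CohomologyVanishes F 0) (Δ : SimplexCategory) :
    Function.Injective ((toCone F).app Δ).hom := by
  refine (injective_iff_map_eq_zero ((toCone F).app Δ).hom).2 fun x hx => ?_
  obtain ⟨a, ha⟩ := (cokerπ_exact (constToDec F) Δ (((toDec F).app Δ).hom x)).1 hx
  have ha' : (F.map (leastVertex Δ)).hom a = (F.map (δ (n := Δ.len) 0)).hom x := ha
  have h1 := congrArg (F.map (shift.map (SimplexCategory.const Δ ⦋0⦌ 0))).hom ha'
  have h2 : (F.map (δ 1)).hom a =
      (F.map (δ 0)).hom ((F.map (SimplexCategory.const Δ ⦋0⦌ 0)).hom x) := by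
    have e1 : leastVertex Δ ≫ shift.map (SimplexCategory.const Δ ⦋0⦌ 0) = δ (n := 0) 1 := by
      ext a : 3
      fin_cases a
      rfl
    have h3 := (map_map_apply (leastVertex Δ)
      (shift.map (SimplexCategory.const Δ ⦋0⦌ 0)) a).symm.trans (h1.trans (map_map_apply _ _ x))
    rw [e1, δ_zero_comp_shift_map] at h3
    exact h3.trans (map_map_apply _ _ x).symm
  have h3 : a = (F.map (SimplexCategory.const Δ ⦋0⦌ 0)).hom x := by
    have h4 := congrArg (F.map (σ 0)).hom h2
    have s1 : δ (n := 0) 1 ≫ σ 0 = 𝟙 _ := SimplexCategory.δ_comp_σ_succ (i := (0 : Fin 1))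
    rw [map_map_apply, map_map_apply, s1, δ_zero_comp_σ_zero, map_id_apply, map_id_apply] at h4
    exact h4
  rw [← h3] at h2
  have h4 : a = 0 := (Submodule.mem_bot K).1 (h a (by
    rw [coboundary_zero_apply, h2, sub_self]))
  apply toDec_injective F Δ
  rw [map_zero, ← ha, h4, map_zero]

end Cone

/-! ### Tensor products of cosimplicial modules -/

section Tensor

variable {K : Type v} [CommRing K] (V : SimplexCategory ⥤ ModuleCat.{u} K)
  {F G C : SimplexCategory ⥤ ModuleCat.{u} K}

/-- The levelwise (diagonal) tensor product of cosimplicial modules. -/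
def tensor (V F : SimplexCategory ⥤ ModuleCat.{u} K) : SimplexCategory ⥤ ModuleCat.{u} K where
  obj Δ := ModuleCat.of K (V.obj Δ ⊗[K] F.obj Δ)
  map θ := ModuleCat.ofHom (TensorProduct.map (V.map θ).hom (F.map θ).hom)
  map_id Δ := by
    ext : 1
    refine TensorProduct.ext' fun v x => ?_
    exact congrArg₂ (· ⊗ₜ[K] ·) (map_id_apply v) (map_id_apply x)
  map_comp θ θ' := by
    ext : 1
    refine TensorProduct.ext' fun v x => ?_
    exact congrArg₂ (· ⊗ₜ[K] ·) (map_map_apply θ θ' v).symm (map_map_apply θ θ' x).symm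

/-- Functoriality of the levelwise tensor product in the second factor. -/
def tensorMap (φ : F ⟶ G) : tensor V F ⟶ tensor V G where
  app Δ := ModuleCat.ofHom ((φ.app Δ).hom.lTensor (V.obj Δ))
  naturality Δ Δ' θ := by
    ext : 1
    refine TensorProduct.ext' fun v x => ?_
    exact congrArg ((V.map θ).hom v ⊗ₜ[K] ·) (naturality_apply φ θ x)

/-- A homotopy on the second factor of a tensor product induces one on the tensor product. -/
def IntervalHomotopy.tensor (H : IntervalHomotopy F) : IntervalHomotopy (tensor V F) where
  act α := (H.act α).lTensor _
  map_act {Δ Δ'} θ α x := by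
    have h : TensorProduct.map (V.map θ).hom (F.map θ).hom ∘ₗ (H.act (θ ≫ α)).lTensor (V.obj Δ) =
        (H.act α).lTensor (V.obj Δ') ∘ₗ TensorProduct.map (V.map θ).hom (F.map θ).hom :=
      TensorProduct.ext' fun v x => congrArg ((V.map θ).hom v ⊗ₜ[K] ·) (H.map_act θ α x)
    exact LinearMap.congr_fun h x

theorem cohomologyVanishes_tensor_cone (n : ℕ) :
    CohomologyVanishes (tensor V (cone F)) n := by
  intro x hx
  have h := ((coneHomotopy F).tensor V).act_sub_act_mem_boundaries n x hx
  have h1 : (coneHomotopy F).act (SimplexCategory.const ⦋n⦌ ⦋1⦌ 1) = LinearMap.id :=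
    LinearMap.ext (coneHomotopy_act_one F _)
  have h0 : (coneHomotopy F).act (SimplexCategory.const ⦋n⦌ ⦋1⦌ 0) = 0 :=
    LinearMap.ext (coneHomotopy_act_zero F _)
  simp only [IntervalHomotopy.tensor, h1, h0, LinearMap.lTensor_id, LinearMap.lTensor_zero] at h
  convert h
  exact (sub_zero x).symm

theorem cohomologyVanishes_cone (n : ℕ) : CohomologyVanishes (cone F) n := by
  intro x hx
  simpa only [coneHomotopy_act_one, coneHomotopy_act_zero, sub_zero] using
    (coneHomotopy F).act_sub_act_mem_boundaries n x hx

end Tensor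

section Kunneth

variable {K : Type v} [Field K] {V : SimplexCategory ⥤ ModuleCat.{u} K}

theorem IsShortExact.tensor {F G C : SimplexCategory ⥤ ModuleCat.{u} K} {φ : F ⟶ G} {π : G ⟶ C}
    (h : IsShortExact φ π) : IsShortExact (tensorMap V φ) (tensorMap V π) where
  injective Δ := Module.Flat.lTensor_preserves_injective_linearMap _ (h.injective Δ)
  exact Δ := lTensor_exact _ (h.exact Δ) (h.surjective Δ)
  surjective Δ := LinearMap.lTensor_surjective _ (h.surjective Δ)

theorem cohomologyVanishes_tensor_zero (hV : CohomologyVanishes V 0)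
    (F : SimplexCategory ⥤ ModuleCat.{u} K) : CohomologyVanishes (tensor V F) 0 := by
  intro x hx
  have hinj : Function.Injective ((V.map (δ (n := 0) 0)).hom - (V.map (δ (n := 0) 1)).hom) := by
    refine (injective_iff_map_eq_zero _).2 fun v hv => (Submodule.mem_bot K).1 (hV v ?_)
    rw [coboundary_zero_apply]
    exact hv
  have hinj' := Module.Flat.rTensor_preserves_injective_linearMap (M := F.obj ⦋0⦌) _ hinj
  refine (Submodule.mem_bot K).2 (hinj' (Eq.trans ?_ (map_zero _).symm))
  -- A codegeneracy on the second factor turns the two coface maps there into identities.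
  have hs (i : Fin 2) : (F.map (σ (n := 0) 0)).hom.lTensor (V.obj ⦋1⦌) ∘ₗ
      ((tensor V F).map (δ i)).hom = (V.map (δ i)).hom.rTensor (F.obj ⦋0⦌) := by
    have e : δ (n := 0) i ≫ σ 0 = 𝟙 _ := by
      fin_cases i
      · exact δ_zero_comp_σ_zero
      · exact SimplexCategory.δ_comp_σ_succ (i := (0 : Fin 1))
    refine TensorProduct.ext' fun v y => ?_
    refine congrArg ((V.map (δ i)).hom v ⊗ₜ[K] ·) ((map_map_apply _ _ y).trans ?_)
    rw [e]
    exact map_id_apply y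
  rw [coboundary_zero_apply] at hx
  rw [LinearMap.rTensor_sub]
  refine (congrArg₂ (· - ·) (LinearMap.congr_fun (hs 0) x).symm
    (LinearMap.congr_fun (hs 1) x).symm).trans ?_
  exact (map_sub ((F.map (σ (n := 0) 0)).hom.lTensor (V.obj ⦋1⦌)) _ _).symm.trans
    ((congrArg _ hx).trans (map_zero _))

/-- A case of the Künneth theorem, proved by dimension shifting along the embedding of `F` into
its cone. -/
theorem cohomologyVanishes_tensor (hV : CohomologyVanishes V 0) (n : ℕ)
    (F : SimplexCategory ⥤ ModuleCat.{u} K) (hF : ∀ m < n, CohomologyVanishes F m) :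
    CohomologyVanishes (tensor V F) n := by
  induction n generalizing F with
  | zero => exact cohomologyVanishes_tensor_zero hV F
  | succ n ih =>
    have h := isShortExact_coker (toCone_injective F (hF 0 n.succ_pos))
    exact h.tensor.cohomologyVanishes_left_succ (cohomologyVanishes_tensor_cone V (n + 1))
      (ih _ fun m hm => h.cohomologyVanishes_right (cohomologyVanishes_cone m)
        (hF (m + 1) (Nat.succ_lt_succ hm)))

end Kunneth

/-! ### Quasi-isomorphisms of cochain complexes -/

section QuasiIso

variable {K : Type v} [CommRing K]

theorem exactAt_iff_cohomologyVanishes (F : SimplexCategory ⥤ ModuleCat.{u} K) (n : ℕ) :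
    ((AlgebraicTopology.alternatingCofaceMapComplex (ModuleCat.{u} K)).obj F).ExactAt n ↔
      CohomologyVanishes F n := by
  have hd (n : ℕ) (x : F.obj ⦋n⦌) : (((AlgebraicTopology.alternatingCofaceMapComplex
      (ModuleCat.{u} K)).obj F).d n (n + 1)).hom x = coboundary F n x := by
    rw [← hom_coboundary]
    exact congrArg (fun f : F.obj ⦋n⦌ ⟶ F.obj ⦋n + 1⦌ => f.hom x)
      (CochainComplex.of_d (fun n => F.obj ⦋n⦌)
        (AlgebraicTopology.AlternatingCofaceMapComplex.objD F) n)
  cases n with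
  | zero =>
    rw [HomologicalComplex.exactAt_iff' _ 0 0 1 (by simp) (by simp),
      ShortComplex.moduleCat_exact_iff]
    have h0 : ((AlgebraicTopology.alternatingCofaceMapComplex (ModuleCat.{u} K)).obj F).d 0 0 = 0 :=
      HomologicalComplex.shape _ _ _ (by simp)
    refine forall_congr' fun x => imp_congr (Eq.congr_left (hd 0 x)) ⟨?_, fun h => ⟨0, ?_⟩⟩
    · rintro ⟨y, rfl⟩
      exact (Submodule.mem_bot K).2 (congrArg (fun f => f.hom y) h0)
    · exact (map_zero _).trans ((Submodule.mem_bot K).1 h).symm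
  | succ n =>
    rw [HomologicalComplex.exactAt_iff' _ n (n + 1) (n + 2) (by simp) (by simp),
      ShortComplex.moduleCat_exact_iff]
    exact forall_congr' fun x => imp_congr (Eq.congr_left (hd (n + 1) x))
      (exists_congr fun y => Eq.congr_left (hd n y))

/-- An injection with acyclic cokernel is a quasi-isomorphism. -/
theorem quasiIso_of_isShortExact {F G C : SimplexCategory ⥤ ModuleCat.{u} K} {φ : F ⟶ G}
    {π : G ⟶ C} (h : IsShortExact φ π) (hC : ∀ n, CohomologyVanishes C n) :
    QuasiIso ((AlgebraicTopology.alternatingCofaceMapComplex (ModuleCat.{u} K)).map φ) := by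
  let A := AlgebraicTopology.alternatingCofaceMapComplex (ModuleCat.{u} K)
  let S : ShortComplex (CochainComplex (ModuleCat.{u} K) ℕ) :=
    ShortComplex.mk (A.map φ) (A.map π) (by
      ext n x
      exact (h.exact ⦋n⦌).apply_apply_eq_zero x)
  have hS : S.ShortExact := HomologicalComplex.shortExact_of_degreewise_shortExact S fun n =>
    { exact := (ShortComplex.moduleCat_exact_iff _).2 fun x hx => (h.exact ⦋n⦌ x).1 hx
      mono_f := (ModuleCat.mono_iff_injective _).2 (h.injective ⦋n⦌)
      epi_g := (ModuleCat.epi_iff_surjective _).2 (h.surjective ⦋n⦌) }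
  have hzero (n : ℕ) : Limits.IsZero (S.X₃.homology n) :=
    ((exactAt_iff_cohomologyVanishes C n).2 (hC n)).isZero_homology
  refine ⟨fun n => ?_⟩
  rw [quasiIsoAt_iff_isIso_homologyMap]
  have hepi : Epi (HomologicalComplex.homologyMap S.f n) :=
    (hS.homology_exact₂ n).epi_f ((hzero n).eq_of_tgt _ _)
  have hmono : Mono (HomologicalComplex.homologyMap S.f n) := by
    cases n with
    | zero =>
      have := hS.mono_f
      exact HomologicalComplex.mono_homologyMap_of_mono_of_not_rel S.f 0 (by simp)
    | succ n => exact (hS.homology_exact₁ n (n + 1) rfl).mono_g ((hzero n).eq_of_src _ _)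
  exact isIso_of_mono_of_epi (HomologicalComplex.homologyMap S.f n)

end QuasiIso

end CosimplicialModule

namespace SymSmooth

/-! ### Smooth functions on a real vector space -/

section ParametricIntegral

variable {E : Type u} [NormedAddCommGroup E] [NormedSpace ℝ E] [FiniteDimensional ℝ E]

/-- Differentiation under the integral sign, with the domination given by compactness. -/
theorem hasFDerivAt_integral_zero_one {G : Type u} [NormedAddCommGroup G] [NormedSpace ℝ G]
    {F : E × ℝ → G} (hF : ContDiff ℝ 1 F) (x : E) :
    HasFDerivAt (fun x => ∫ t in (0 : ℝ)..1, F (x, t))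
      (∫ t in (0 : ℝ)..1, (fderiv ℝ F (x, t)).comp (ContinuousLinearMap.inl ℝ E ℝ)) x := by
  have hF' : Continuous fun p : E × ℝ =>
      (fderiv ℝ F p).comp (ContinuousLinearMap.inl ℝ E ℝ) :=
    (hF.continuous_fderiv one_ne_zero).clm_comp continuous_const
  obtain ⟨C, hC⟩ := ((isCompact_closedBall x 1).prod (isCompact_Icc (a := (0 : ℝ)) (b := 1)))
    |>.exists_bound_of_continuousOn hF'.continuousOn
  refine intervalIntegral.hasFDerivAt_integral_of_dominated_of_fderiv_le (bound := fun _ => C)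
    (F := fun x t => F (x, t))
    (F' := fun x t => (fderiv ℝ F (x, t)).comp (ContinuousLinearMap.inl ℝ E ℝ))
    (Metric.closedBall_mem_nhds x one_pos) (Filter.Eventually.of_forall fun y => ?_) ?_ ?_ ?_ ?_ ?_
  · exact (hF.continuous.comp (by fun_prop : Continuous fun t : ℝ => (y, t))).aestronglyMeasurable
  · exact (hF.continuous.comp (by fun_prop : Continuous fun t : ℝ => (x, t))).intervalIntegrable _ _
  · exact (hF'.comp (by fun_prop : Continuous fun t : ℝ => (x, t))).aestronglyMeasurable
  · refine Filter.Eventually.of_forall fun t ht y hy => hC (y, t) ⟨hy, ?_⟩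
    rw [Set.uIoc_of_le zero_le_one] at ht
    exact ⟨ht.1.le, ht.2⟩
  · exact intervalIntegrable_const
  · refine Filter.Eventually.of_forall fun t _ y _ => ?_
    have h1 := (hF.differentiable one_ne_zero (y, t)).hasFDerivAt
    have h2 : HasFDerivAt (fun y : E => (y, t)) (ContinuousLinearMap.inl ℝ E ℝ) y :=
      hasFDerivAt_prodMk_left y t
    exact h1.comp y h2

theorem contDiff_nat_integral_zero_one (n : ℕ) {G : Type u} [NormedAddCommGroup G]
    [NormedSpace ℝ G] {F : E × ℝ → G} (hF : ContDiff ℝ ∞ F) :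
    ContDiff ℝ n (fun x => ∫ t in (0 : ℝ)..1, F (x, t)) := by
  induction n generalizing G with
  | zero =>
    exact contDiff_zero.2 (continuous_iff_continuousAt.2 fun x =>
      (hasFDerivAt_integral_zero_one (hF.of_le (by exact_mod_cast le_top)) x).continuousAt)
  | succ n ih =>
    exact contDiff_succ_iff_hasFDerivAt.2 ⟨_,
      ih (F := fun p => (fderiv ℝ F p).comp (ContinuousLinearMap.inl ℝ E ℝ))
        ((hF.fderiv_right (m := ∞) (by simp)).clm_comp contDiff_const),
      fun x => hasFDerivAt_integral_zero_one (hF.of_le (by exact_mod_cast le_top)) x⟩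

theorem contDiff_integral_zero_one {G : Type u} [NormedAddCommGroup G]
    [NormedSpace ℝ G] {F : E × ℝ → G} (hF : ContDiff ℝ ∞ F) :
    ContDiff ℝ ∞ (fun x => ∫ t in (0 : ℝ)..1, F (x, t)) :=
  contDiff_infty.2 fun n => contDiff_nat_integral_zero_one n hF

end ParametricIntegral

section Derivative

variable {X : Type u} [AddCommGroup X] [Module ℝ X]

theorem isSmooth_coe (f : smoothFunctions X) : IsSmooth (f : X → ℝ) := f.2

theorem IsSmooth.contDiff_comp {f : X → ℝ} (hf : IsSmooth f) {E : Type*} [NormedAddCommGroup E]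
    [NormedSpace ℝ E] [FiniteDimensional ℝ E] (L : E →ₗ[ℝ] X) : ContDiff ℝ ∞ fun x => f (L x) := by
  let e := (Module.finBasis ℝ E).equivFun
  have h := (hf _ (L ∘ₗ e.symm.toLinearMap)).comp
    (LinearMap.toContinuousLinearMap e.toLinearMap).contDiff
  convert h using 1
  ext x
  simp

/-- The derivative of a function on a real vector space at a point in a given direction. No norm
on the vector space is needed. -/
def directionalDeriv (v : X) (f : X → ℝ) (x : X) : ℝ := deriv (fun t : ℝ => f (x + t • v)) 0

/-- Directional derivatives can be computed after restriction to a normed space. -/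
theorem directionalDeriv_eq_fderiv {f : X → ℝ} (hf : IsSmooth f) {E : Type*}
    [NormedAddCommGroup E] [NormedSpace ℝ E] [FiniteDimensional ℝ E] (L : E →ₗ[ℝ] X) (x v : E) :
    directionalDeriv (L v) f (L x) = fderiv ℝ (fun x => f (L x)) x v := by
  have h1 : HasFDerivAt (fun x => f (L x)) (fderiv ℝ (fun x => f (L x)) x) (x + (0 : ℝ) • v) := by
    rw [zero_smul, add_zero]
    exact ((hf.contDiff_comp L).differentiable (by simp) x).hasFDerivAt
  have h2 : HasDerivAt (fun t : ℝ => x + t • v) v 0 := by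
    simpa using ((hasDerivAt_id (0 : ℝ)).smul_const v).const_add x
  have h3 := (h1.comp_hasDerivAt (0 : ℝ) h2).deriv
  rw [← h3, directionalDeriv]
  simp [Function.comp_def]

theorem IsSmooth.differentiable_line {f : X → ℝ} (hf : IsSmooth f) (x v : X) :
    Differentiable ℝ fun t : ℝ => f (x + t • v) := by
  have h := (hf.contDiff_comp (LinearMap.coprod (LinearMap.toSpanSingleton ℝ X x)
    (LinearMap.toSpanSingleton ℝ X v))).differentiable (by simp)
  have h' := h.comp (f := fun t : ℝ => ((1 : ℝ), t)) (by fun_prop)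
  simpa [Function.comp_def] using h'

theorem IsSmooth.continuous_ray {f : X → ℝ} (hf : IsSmooth f) (x : X) :
    Continuous fun t : ℝ => f (t • x) := by
  simpa using (hf.differentiable_line 0 x).continuous

theorem IsSmooth.directionalDeriv {f : X → ℝ} (hf : IsSmooth f) (v : X) :
    IsSmooth (directionalDeriv v f) := by
  intro n L
  let L' : (Fin n → ℝ) × ℝ →ₗ[ℝ] X := L.coprod (LinearMap.toSpanSingleton ℝ X v)
  have h (x : Fin n → ℝ) : SymSmooth.directionalDeriv v f (L x) =
      fderiv ℝ (fun x => f (L' x)) (x, 0) (0, 1) := by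
    rw [← directionalDeriv_eq_fderiv hf]
    simp [L']
  simp only [h]
  have h1 := (hf.contDiff_comp L').fderiv_right (m := ∞) (by simp)
  exact (h1.comp (by fun_prop : ContDiff ℝ ∞ fun x : Fin n → ℝ => (x, (0 : ℝ)))).clm_apply
    contDiff_const

theorem IsSmooth.integral_ray {f : X → ℝ} (hf : IsSmooth f) :
    IsSmooth fun x => ∫ t in (0 : ℝ)..1, f (t • x) := by
  intro n L
  have h := contDiff_integral_zero_one (F := fun p : (Fin n → ℝ) × ℝ => f (L (p.2 • p.1)))
    ((hf n L).comp (by fun_prop : ContDiff ℝ ∞ fun p : (Fin n → ℝ) × ℝ => p.2 • p.1))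
  simpa only [map_smul] using h

variable (X) in
/-- The directional derivative as a bilinear map. -/
def dirDeriv : X →ₗ[ℝ] smoothFunctions X →ₗ[ℝ] smoothFunctions X :=
  LinearMap.mk₂ ℝ (fun v f => ⟨directionalDeriv v f, (isSmooth_coe f).directionalDeriv v⟩)
    (fun v w f => Subtype.ext (funext fun x => by
      have h (a : ℝ × ℝ) := directionalDeriv_eq_fderiv (isSmooth_coe f)
        ((LinearMap.toSpanSingleton ℝ X x).coprod ((LinearMap.toSpanSingleton ℝ X v).coprod
          (LinearMap.toSpanSingleton ℝ X w))) (1, 0) (0, a)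
      simp only [LinearMap.coprod_apply, LinearMap.toSpanSingleton_apply, Prod.fst_zero,
        Prod.snd_zero, zero_smul, one_smul, add_zero, zero_add] at h
      have h1 := h (1, 1)
      have h2 := h (1, 0)
      have h3 := h (0, 1)
      simp only [zero_smul, one_smul, add_zero, zero_add] at h1 h2 h3
      change directionalDeriv (v + w) f x = directionalDeriv v f x + directionalDeriv w f x
      rw [h1, h2, h3, ← map_add]
      simp))
    (fun c v f => Subtype.ext (funext fun x => by
      have h (a : ℝ) := directionalDeriv_eq_fderiv (isSmooth_coe f)
        ((LinearMap.toSpanSingleton ℝ X x).coprod (LinearMap.toSpanSingleton ℝ X v)) (1, 0) (0, a)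
      simp only [LinearMap.coprod_apply, LinearMap.toSpanSingleton_apply, zero_smul, one_smul,
        add_zero, zero_add] at h
      have h1 := h 1
      rw [one_smul] at h1
      change directionalDeriv (c • v) f x = c * directionalDeriv v f x
      rw [h, h1, ← smul_eq_mul, ← map_smul]
      simp))
    (fun v f g => Subtype.ext (funext fun x =>
      deriv_add ((isSmooth_coe f).differentiable_line x v 0)
        ((isSmooth_coe g).differentiable_line x v 0)))
    (fun c v f => Subtype.ext (funext fun x =>
      deriv_const_mul c ((isSmooth_coe f).differentiable_line x v 0)))

theorem dirDeriv_mul (v : X) (f g : smoothFunctions X) :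
    dirDeriv X v (f * g) = dirDeriv X v f * g + f * dirDeriv X v g := by
  refine Subtype.ext (funext fun x => ?_)
  have h := deriv_mul ((isSmooth_coe f).differentiable_line x v 0)
    ((isSmooth_coe g).differentiable_line x v 0)
  rw [zero_smul, add_zero] at h
  exact h

theorem dirDeriv_algebraMap (v : X) (r : ℝ) :
    dirDeriv X v (algebraMap ℝ (smoothFunctions X) r) = 0 :=
  Subtype.ext (funext fun _ => deriv_const _ r)

theorem dirDeriv_evalDual {W : Type u} [AddCommGroup W] [Module ℝ W] (φ : Module.Dual ℝ W) (w : W) :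
    dirDeriv _ φ (evalDual W w) = algebraMap ℝ _ (φ w) := by
  refine Subtype.ext (funext fun ψ => ?_)
  have h : HasDerivAt (fun t : ℝ => ψ w + t * φ w) (φ w) 0 := by
    simpa using ((hasDerivAt_id (0 : ℝ)).mul_const (φ w)).const_add (ψ w)
  exact h.deriv

variable (X) in
/-- The mean of a smooth function along the segments from the origin. -/
def radialMean : smoothFunctions X →ₗ[ℝ] smoothFunctions X where
  toFun f := ⟨fun x => ∫ t in (0 : ℝ)..1, (f : X → ℝ) (t • x), (isSmooth_coe f).integral_ray⟩
  map_add' f g := Subtype.ext (funext fun x => intervalIntegral.integral_add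
    (((isSmooth_coe f).continuous_ray x).intervalIntegrable _ _)
    (((isSmooth_coe g).continuous_ray x).intervalIntegrable _ _))
  map_smul' c _ := Subtype.ext (funext fun _ => intervalIntegral.integral_const_mul c _)

variable (X) in
/-- The coefficients in Hadamard's lemma: the mean of the derivative of a function in a given
direction along the segments from the origin. -/
def hadamard : X →ₗ[ℝ] smoothFunctions X →ₗ[ℝ] smoothFunctions X :=
  (dirDeriv X).compr₂ (radialMean X)

theorem hadamard_apply (v : X) (f : smoothFunctions X) (x : X) :
    (hadamard X v f : X → ℝ) x = ∫ t in (0 : ℝ)..1, directionalDeriv v f (t • x) := rfl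

/-- Hadamard's lemma along the segment from the origin to `x`. -/
theorem hadamard_self_apply (f : smoothFunctions X) (x : X) :
    (hadamard X x f : X → ℝ) x = (f : X → ℝ) x - (f : X → ℝ) 0 := by
  have h (t : ℝ) : HasDerivAt (fun t : ℝ => (f : X → ℝ) (t • x))
      (directionalDeriv x f (t • x)) t := by
    have h1 := directionalDeriv_eq_fderiv (isSmooth_coe f) (LinearMap.toSpanSingleton ℝ X x) t 1
    simp only [LinearMap.toSpanSingleton_apply, one_smul] at h1
    rw [h1, fderiv_apply_one_eq_deriv]
    refine DifferentiableAt.hasDerivAt ?_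
    simpa using (isSmooth_coe f).differentiable_line 0 x t
  rw [hadamard_apply, intervalIntegral.integral_eq_sub_of_hasDerivAt (fun t _ => h t)
    ((IsSmooth.continuous_ray ((isSmooth_coe f).directionalDeriv x) x).intervalIntegrable _ _),
    one_smul, zero_smul]

theorem hadamard_smoothPullback {X' : Type u} [AddCommGroup X'] [Module ℝ X'] (g : X →ₗ[ℝ] X')
    (v : X) (f : smoothFunctions X') :
    hadamard X v (smoothPullback g f) = smoothPullback g (hadamard X' (g v) f) := by
  refine Subtype.ext (funext fun x => ?_)
  simp [hadamard_apply, smoothPullback, directionalDeriv]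

end Derivative

/-! ### Polynomial functions -/

section Polynomial

variable {W W' : Type u} [AddCommGroup W] [Module ℝ W] [AddCommGroup W'] [Module ℝ W']

theorem symToSmooth_ι (w : W) : symToSmooth W (SymmetricAlgebra.ι ℝ W w) = evalDual W w :=
  SymmetricAlgebra.lift_ι_apply _ _

theorem symToSmooth_injective [FiniteDimensional ℝ W] : Function.Injective (symToSmooth W) := by
  let b := Module.finBasis ℝ W
  let e := SymmetricAlgebra.equivMvPolynomial b
  have key (p : MvPolynomial _ ℝ) (φ : Module.Dual ℝ W) :
      (symToSmooth W (e.symm p) : Module.Dual ℝ W → ℝ) φ =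
        MvPolynomial.eval (fun i => φ (b i)) p := by
    induction p using MvPolynomial.induction_on with
    | C r =>
      rw [← MvPolynomial.algebraMap_eq, AlgEquiv.commutes, AlgHom.commutes,
        MvPolynomial.algebraMap_eq, MvPolynomial.eval_C]
      rfl
    | add p q hp hq =>
      rw [map_add, map_add, map_add, ← hp, ← hq]
      rfl
    | mul_X p i hp =>
      rw [map_mul, map_mul, map_mul, ← hp, MvPolynomial.eval_X,
        SymmetricAlgebra.equivMvPolynomial_symm_X, symToSmooth_ι]
      rfl
  refine (injective_iff_map_eq_zero (symToSmooth W)).2 fun a ha => ?_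
  refine (map_eq_zero_iff e e.injective).1 (MvPolynomial.funext fun c => ?_)
  have h := key (e a) (b.constr ℝ c)
  rw [e.symm_apply_apply, ha] at h
  simpa using h.symm

theorem dirDeriv_symToSmooth_mem_range (φ : Module.Dual ℝ W) (a : SymmetricAlgebra ℝ W) :
    dirDeriv _ φ (symToSmooth W a) ∈ (symToSmooth W).range := by
  induction a using SymmetricAlgebra.induction with
  | algebraMap r =>
    rw [AlgHom.commutes, dirDeriv_algebraMap]
    exact zero_mem _
  | ι w =>
    rw [symToSmooth_ι, dirDeriv_evalDual]
    exact Subalgebra.algebraMap_mem _ _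
  | mul x y hx hy =>
    rw [map_mul, dirDeriv_mul]
    exact add_mem (mul_mem hx ⟨y, rfl⟩) (mul_mem ⟨x, rfl⟩ hy)
  | add x y hx hy =>
    rw [map_add, map_add]
    exact add_mem hx hy

variable (W) in
/-- The multiplicative monoid of homogeneous polynomial functions on the dual of a vector space. -/
def homogeneousPolynomials : Submonoid (smoothFunctions (Module.Dual ℝ W)) where
  carrier := {f | f ∈ (symToSmooth W).range ∧ ∃ k : ℕ, ∀ (t : ℝ) (φ : Module.Dual ℝ W),
    (f : Module.Dual ℝ W → ℝ) (t • φ) = t ^ k * (f : Module.Dual ℝ W → ℝ) φ}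
  one_mem' := ⟨one_mem _, 0, fun t φ => by simp⟩
  mul_mem' := by
    rintro f g ⟨hf, k, hk⟩ ⟨hg, l, hl⟩
    refine ⟨mul_mem hf hg, k + l, fun t φ => ?_⟩
    change (f : Module.Dual ℝ W → ℝ) (t • φ) * (g : Module.Dual ℝ W → ℝ) (t • φ) =
      t ^ (k + l) * ((f : Module.Dual ℝ W → ℝ) φ * (g : Module.Dual ℝ W → ℝ) φ)
    rw [hk, hl]
    ring

theorem symToSmooth_mem_span_homogeneousPolynomials (a : SymmetricAlgebra ℝ W) :
    symToSmooth W a ∈ Submodule.span ℝ (homogeneousPolynomials W : Set _) := by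
  have h : symToSmooth W a ∈ Algebra.adjoin ℝ (homogeneousPolynomials W : Set _) := by
    induction a using SymmetricAlgebra.induction with
    | algebraMap r =>
      rw [AlgHom.commutes]
      exact Subalgebra.algebraMap_mem _ _
    | ι w =>
      refine Algebra.subset_adjoin ⟨⟨_, rfl⟩, 1, fun t φ => ?_⟩
      rw [symToSmooth_ι, pow_one]
      rfl
    | mul x y hx hy =>
      rw [map_mul]
      exact mul_mem hx hy
    | add x y hx hy =>
      rw [map_add]
      exact add_mem hx hy
  rw [← Subalgebra.mem_toSubmodule, Algebra.adjoin_eq_span, Submonoid.closure_eq] at h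
  exact h

/-- On homogeneous polynomials of degree `k`, the radial mean is division by `k + 1`. -/
theorem radialMean_symToSmooth_mem_range (a : SymmetricAlgebra ℝ W) :
    radialMean _ (symToSmooth W a) ∈ (symToSmooth W).range := by
  generalize symToSmooth W a = p, symToSmooth_mem_span_homogeneousPolynomials a = hp
  induction hp using Submodule.span_induction with
  | mem f hf =>
    obtain ⟨hf, k, hk⟩ := hf
    have h : radialMean _ f = ((k : ℝ) + 1)⁻¹ • f := by
      refine Subtype.ext (funext fun φ => ?_)
      change ∫ t in (0 : ℝ)..1, (f : Module.Dual ℝ W → ℝ) (t • φ) =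
        ((k : ℝ) + 1)⁻¹ * (f : Module.Dual ℝ W → ℝ) φ
      simp [hk]
    rw [h]
    exact Subalgebra.smul_mem _ hf _
  | zero => rw [map_zero]; exact zero_mem _
  | add f g _ _ hf hg => rw [map_add]; exact add_mem hf hg
  | smul c f _ hf => rw [map_smul]; exact Subalgebra.smul_mem _ hf c

theorem hadamard_symToSmooth_mem_range (φ : Module.Dual ℝ W) (a : SymmetricAlgebra ℝ W) :
    hadamard _ φ (symToSmooth W a) ∈ (symToSmooth W).range := by
  obtain ⟨b, hb⟩ := dirDeriv_symToSmooth_mem_range φ a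
  change radialMean _ (dirDeriv _ φ (symToSmooth W a)) ∈ _
  rw [← show symToSmooth W b = _ from hb]
  exact radialMean_symToSmooth_mem_range b

/-! ### Smooth functions modulo polynomial functions -/

variable (W) in
/-- The space of smooth functions on the dual of a vector space modulo polynomial functions. -/
abbrev SmoothModPoly : Type u :=
  smoothFunctions (Module.Dual ℝ W) ⧸ LinearMap.range (symToSmooth W).toLinearMap

variable (W) in
/-- The class of a smooth function modulo polynomial functions. -/
abbrev toModPoly : smoothFunctions (Module.Dual ℝ W) →ₗ[ℝ] SmoothModPoly W := Submodule.mkQ _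

namespace SmoothModPoly

/-- Functoriality of smooth functions modulo polynomial functions. -/
def map (g : W →ₗ[ℝ] W') : SmoothModPoly W →ₗ[ℝ] SmoothModPoly W' :=
  Submodule.mapQ _ _ (smoothPullback g.dualMap) (by
    rintro _ ⟨a, rfl⟩
    exact ⟨symMap g a, symToSmooth_naturality g a⟩)

variable (W) in
/-- Multiplication by linear functions. -/
def mul : W ⊗[ℝ] SmoothModPoly W →ₗ[ℝ] SmoothModPoly W :=
  TensorProduct.lift
    { toFun := fun w => Submodule.mapQ _ _ (LinearMap.mulLeft ℝ (evalDual W w)) (by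
        rintro _ ⟨a, rfl⟩
        refine ⟨SymmetricAlgebra.ι ℝ W w * a, ?_⟩
        change symToSmooth W _ = evalDual W w * symToSmooth W a
        rw [map_mul, symToSmooth_ι])
      map_add' := fun v w => by
        refine Submodule.linearMap_qext _ (LinearMap.ext fun f => ?_)
        refine congrArg (toModPoly W) ?_
        change evalDual W (v + w) * f = evalDual W v * f + evalDual W w * f
        rw [map_add, add_mul]
      map_smul' := fun c w => by
        refine Submodule.linearMap_qext _ (LinearMap.ext fun f => ?_)
        refine congrArg (toModPoly W) ?_
        change evalDual W (c • w) * f = c • (evalDual W w * f)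
        rw [map_smul, smul_mul_assoc] }

theorem map_mul_tmul (g : W →ₗ[ℝ] W') (w : W) (q : SmoothModPoly W) :
    map g (mul W (w ⊗ₜ q)) = mul W' (g w ⊗ₜ map g q) := by
  obtain ⟨f, rfl⟩ := Submodule.mkQ_surjective _ q
  rfl

variable (W) in
/-- The Hadamard coefficients of smooth functions modulo polynomial functions. -/
def coeff : Module.Dual ℝ W →ₗ[ℝ] SmoothModPoly W →ₗ[ℝ] SmoothModPoly W where
  toFun φ := Submodule.mapQ _ _ (hadamard _ φ) (by
    rintro _ ⟨a, rfl⟩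
    exact hadamard_symToSmooth_mem_range φ a)
  map_add' φ ψ := by
    refine Submodule.linearMap_qext _ (LinearMap.ext fun f => ?_)
    refine congrArg (toModPoly W) ?_
    rw [map_add]
    rfl
  map_smul' c φ := by
    refine Submodule.linearMap_qext _ (LinearMap.ext fun f => ?_)
    refine congrArg (toModPoly W) ?_
    rw [map_smul]
    rfl

theorem coeff_map (g : W →ₗ[ℝ] W') (φ : Module.Dual ℝ W') (q : SmoothModPoly W) :
    coeff W' φ (map g q) = map g (coeff W (g.dualMap φ) q) := by
  obtain ⟨f, rfl⟩ := Submodule.mkQ_surjective _ q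
  exact congrArg (toModPoly W') (hadamard_smoothPullback g.dualMap φ f)

variable [FiniteDimensional ℝ W] [FiniteDimensional ℝ W']

variable (W) in
/-- The tensor `∑ i, e i ⊗ coeff (e^∨ i) q` of Hadamard coefficients of `q`, for a basis `e` of `W`
with dual basis `e^∨`. It does not depend on the basis, which `split_map` reflects. -/
def split : SmoothModPoly W →ₗ[ℝ] W ⊗[ℝ] SmoothModPoly W :=
  ∑ i, TensorProduct.mk ℝ W (SmoothModPoly W) (Module.finBasis ℝ W i) ∘ₗ
    coeff W ((Module.finBasis ℝ W).coord i)

theorem split_apply (q : SmoothModPoly W) :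
    split W q = ∑ i, Module.finBasis ℝ W i ⊗ₜ[ℝ] coeff W ((Module.finBasis ℝ W).coord i) q := by
  simp [split]

/-- Hadamard's lemma, in which the value of the function at the origin is a polynomial. -/
theorem mul_split (q : SmoothModPoly W) : mul W (split W q) = q := by
  obtain ⟨f, rfl⟩ := Submodule.mkQ_surjective _ q
  rw [split_apply, map_sum]
  have h : ∑ i, evalDual W (Module.finBasis ℝ W i) *
      hadamard _ ((Module.finBasis ℝ W).coord i) f =
      f - algebraMap ℝ _ ((f : Module.Dual ℝ W → ℝ) 0) := by
    refine Subtype.ext (funext fun φ => ?_)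
    refine Eq.trans ?_ (hadamard_self_apply f φ)
    conv_rhs => rw [← (Module.finBasis ℝ W).sum_dual_apply_smul_coord φ]
    simp only [map_sum, map_smul, LinearMap.sum_apply, LinearMap.smul_apply,
      AddSubmonoidClass.coe_finsetSum, Finset.sum_apply]
    rw [(Module.finBasis ℝ W).sum_dual_apply_smul_coord φ]
    rfl
  have h' := congrArg (toModPoly W) h
  rw [map_sum, map_sub] at h'
  refine h'.trans (sub_eq_self.2 ((Submodule.Quotient.mk_eq_zero _).2 ?_))
  exact ⟨algebraMap ℝ _ _, (symToSmooth W).commutes _⟩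

theorem split_map (g : W →ₗ[ℝ] W') (q : SmoothModPoly W) :
    split W' (map g q) = TensorProduct.map g (map g) (split W q) := by
  simp only [split_apply, map_sum, TensorProduct.map_tmul, coeff_map]
  have h (i) : g (Module.finBasis ℝ W i) =
      ∑ j, (Module.finBasis ℝ W').coord j (g (Module.finBasis ℝ W i)) • Module.finBasis ℝ W' j :=
    ((Module.finBasis ℝ W').sum_repr _).symm
  have h' (j) : g.dualMap ((Module.finBasis ℝ W').coord j) =
      ∑ i, (Module.finBasis ℝ W').coord j (g (Module.finBasis ℝ W i)) •
        (Module.finBasis ℝ W).coord i :=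
    ((Module.finBasis ℝ W).sum_dual_apply_smul_coord _).symm
  simp_rw [h']
  conv_rhs => enter [2, i]; rw [h]
  simp only [map_sum, LinearMap.sum_apply, map_smul, LinearMap.smul_apply, TensorProduct.tmul_sum,
    TensorProduct.sum_tmul, TensorProduct.tmul_smul, TensorProduct.smul_tmul']
  exact Finset.sum_comm

end SmoothModPoly

end Polynomial

/-! ### Cosimplicial vector spaces -/

section Cosimplicial

open CosimplicialModule

variable (V : SimplexCategory ⥤ ModuleCat.{u} ℝ)

/-- The morphism `cosimplicialSymToSmooth` as a morphism of functors on the simplex category. -/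
def symToSmoothHom : V ⋙ symFunctor ⟶ V ⋙ smoothDualFunctor :=
  Functor.whiskerLeft V symToSmoothNatTrans

/-- The cosimplicial vector space of smooth functions modulo polynomial functions. -/
abbrev smoothModPoly : SimplexCategory ⥤ ModuleCat.{u} ℝ := coker (symToSmoothHom V)

variable [∀ Δ, FiniteDimensional ℝ (V.obj Δ)]

/-- The Hadamard coefficients as a morphism of cosimplicial vector spaces. -/
def splitHom : smoothModPoly V ⟶ tensor V (smoothModPoly V) where
  app Δ := ModuleCat.ofHom (SmoothModPoly.split (V.obj Δ))
  naturality Δ Δ' θ := by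
    ext q
    exact SmoothModPoly.split_map (V.map θ).hom q

/-- Multiplication by linear functions as a morphism of cosimplicial vector spaces. -/
def mulHom : tensor V (smoothModPoly V) ⟶ smoothModPoly V where
  app Δ := ModuleCat.ofHom (SmoothModPoly.mul (V.obj Δ))
  naturality Δ Δ' θ := by
    ext : 1
    exact TensorProduct.ext' fun v q => (SmoothModPoly.map_mul_tmul (V.map θ).hom v q).symm

theorem splitHom_comp_mulHom : splitHom V ≫ mulHom V = 𝟙 _ := by
  ext Δ q
  exact SmoothModPoly.mul_split (W := V.obj Δ) q

theorem cohomologyVanishes_smoothModPoly (hV : CohomologyVanishes V 0) (n : ℕ) :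
    CohomologyVanishes (smoothModPoly V) n := by
  induction n using Nat.strong_induction_on with
  | _ n ih =>
    exact (cohomologyVanishes_tensor hV n _ ih).of_retract _ _ (splitHom_comp_mulHom V)

end Cosimplicial

end SymSmooth

end

theorem proposition3p5
    (V : CategoryTheory.CosimplicialObject (ModuleCat.{u} ℝ))
    (hfin : ∀ n : SimplexCategory, FiniteDimensional ℝ (V.obj n))
    (hH0 : CategoryTheory.Limits.IsZero ((SymSmooth.cochains.obj V).homology 0)) :
    QuasiIso (SymSmooth.cochains.map (SymSmooth.cosimplicialSymToSmooth V)) := by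
  have hV : CosimplicialModule.CohomologyVanishes V 0 :=
    (CosimplicialModule.exactAt_iff_cohomologyVanishes V 0).1
      ((HomologicalComplex.exactAt_iff_isZero_homology _ _).2 hH0)
  have h : ∀ Δ, Function.Injective ((SymSmooth.symToSmoothHom V).app Δ).hom := fun Δ =>
    have := hfin Δ
    SymSmooth.symToSmooth_injective
  exact CosimplicialModule.quasiIso_of_isShortExact (CosimplicialModule.isShortExact_coker h)
    (have := hfin; SymSmooth.cohomologyVanishes_smoothModPoly V hV)
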